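/- Let $\hat T=\{(x,y)\in\mathbb R^2: x\ge 0,\ y\ge 0,\ x+y\le 1\}$ and let $\Gamma_h=\bigcup_{T\in\mathcal T_h}T\subset\mathbb R^3$ be a finite consistent mesh of curved triangles $T=\Phi_T(\hat T)$: each $\Phi_T$ is a polynomial map of order $k_g$ (any $k_g$), injective on $\hat T$, whose Jacobian $F=\Phi_T'\in\mathbb R^{3\times 2}$ has rank $2$ on $\hat T$; two different triangles are disjoint or meet exactly in a common vertex or in a common edge; and every edge belongs to at most two triangles. $\Gamma_h$ may be closed or have a boundary. Put $J=\sqrt{\det(F^TF)}$, let $\boldsymbol n$ be a unit normal of $T$, $P=I-\boldsymbol n\boldsymbol n^T$, let $\boldsymbol\mu_T$ be the in-plane outer unit normal on $\partial T$, and let $\nabla_\Gamma v=P\,\nabla v^p\,P$ (with $v^p$ a differentiable extension of $v|_T$) and $\operatorname{div}_\Gamma v=\operatorname{tr}\nabla_\Gamma v$ on each $T$. For $k_u\ge 1$ let $V_h^{k_u}$ be the space of all piecewise defined vector fields $v$ on $\Gamma_h$ such that - for every $T$ there is $\hat v\in[\mathbb P^{k_u}(\hat T)]^2$ with $v|_T(\Phi_T(\hat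 x))=\tfrac1J F\,\hat v(\hat x)$ for $\hat x\in\hat T$, and - $v|_{T}\cdot\boldsymbol\mu_{T}+v|_{T'}\cdot\boldsymbol\mu_{T'}=0$ on every edge common to two triangles $T,T'$, and $v\cdot\boldsymbol\mu_T=0$ on every edge belonging to one triangle $T$ only. Let $Q_h^{k_u-1}$ be the space of all piecewise defined functions $q$ on $\Gamma_h$ with $\int_{\Gamma_h}q=0$ such that for every $T$ there is $\hat q\in\mathbb P^{k_u-1}(\hat T)$ with $q|_T=\hat q\circ\Phi_T^{-1}$. If $u_h\in V_h^{k_u}$ satisfies $$b_h(u_h,q_h)=-\int_{\Gamma_h}\operatorname{div}_\Gamma(u_h)\,q_h=0\qquad\text{for all } q_h\in Q_h^{k_u-1},$$ then $u_h$ is exactly divergence-free: on every (closed) triangle $T$, $u_h|_T$ is differentiable and $\operatorname{div}_\Gamma(u_h)=0$ at every point. -/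

import Mathlib

open scoped Matrix

noncomputable section

/-! Points of the reference plane are `Fin 2 → ℝ`, points and vectors of the ambient space are
`Fin 3 → ℝ`. The Euclidean structure is used only through the dot product `⬝ᵥ`; the sup norms
of these types enter only through topology and differentiability, which do not depend on the
choice of a norm. -/

/-- The vector `v` divided by its Euclidean length. -/
def unitVec (v : Fin 3 → ℝ) : Fin 3 → ℝ := (Real.sqrt (v ⬝ᵥ v))⁻¹ • v

/-- The closed reference triangle with vertices `(0,0)`, `(1,0)`, `(0,1)`. -/
def refTriangle : Set (Fin 2 → ℝ) := {x | 0 ≤ x 0 ∧ 0 ≤ x 1 ∧ x 0 + x 1 ≤ 1}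

/-- The vertices of the reference triangle, in counterclockwise order. -/
def refVertex : Fin 3 → (Fin 2 → ℝ) := ![![0, 0], ![1, 0], ![0, 1]]

/-- The closed edge `e` of the reference triangle, from vertex `e` to vertex `e + 1` (mod 3). -/
def refEdge (e : Fin 3) : Set (Fin 2 → ℝ) := segment ℝ (refVertex e) (refVertex (e + 1))

/-- The counterclockwise direction of the edge `e` of the reference triangle. -/
def refTangent (e : Fin 3) : Fin 2 → ℝ := refVertex (e + 1) - refVertex e

/-- The map `ℝ² → ℝ³` whose components are the given polynomials. -/
def polyMap (p : Fin 3 → MvPolynomial (Fin 2) ℝ) (x : Fin 2 → ℝ) : Fin 3 → ℝ :=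
  fun i => MvPolynomial.eval x (p i)

/-- The Jacobian matrix (3 rows, 2 columns) of `polyMap p`. -/
def polyJac (p : Fin 3 → MvPolynomial (Fin 2) ℝ) (x : Fin 2 → ℝ) : Matrix (Fin 3) (Fin 2) ℝ :=
  Matrix.of fun i j => MvPolynomial.eval x (MvPolynomial.pderiv j (p i))

/-- A consistent mesh of curved triangles in `ℝ³`, with elements indexed by `ι` and polynomial
element maps of order `kg`. Closed surfaces and surfaces with boundary are both allowed. -/
structure SurfaceMesh (ι : Type*) (kg : ℕ) where
  /-- the components of the element maps -/
  poly : ι → Fin 3 → MvPolynomial (Fin 2) ℝ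
  /-- the element maps have order `kg` -/
  degree_le : ∀ T i, (poly T i).totalDegree ≤ kg
  /-- every element map is one-to-one on the reference triangle -/
  injOn : ∀ T, Set.InjOn (polyMap (poly T)) refTriangle
  /-- the element maps are not degenerate: the two columns of the Jacobian are independent -/
  rank_eq : ∀ T, ∀ x ∈ refTriangle, (polyJac (poly T) x).rank = 2
  /-- two different elements are disjoint, or meet exactly in a common vertex, or meet exactly
  in a common edge -/
  consistent : ∀ T T', T ≠ T' →
    (polyMap (poly T) '' refTriangle) ∩ (polyMap (poly T') '' refTriangle) = ∅ ∨
    (∃ i j, polyMap (poly T) (refVertex i) = polyMap (poly T') (refVertex j) ∧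
      (polyMap (poly T) '' refTriangle) ∩ (polyMap (poly T') '' refTriangle) =
        {polyMap (poly T) (refVertex i)}) ∨
    (∃ e e', polyMap (poly T) '' refEdge e = polyMap (poly T') '' refEdge e' ∧
      (polyMap (poly T) '' refTriangle) ∩ (polyMap (poly T') '' refTriangle) =
        polyMap (poly T) '' refEdge e)
  /-- an edge belongs to at most two elements -/
  edge_le_two : ∀ T T' T'' e e' e'', T' ≠ T → T'' ≠ T →
    polyMap (poly T) '' refEdge e = polyMap (poly T') '' refEdge e' →
    polyMap (poly T) '' refEdge e = polyMap (poly T'') '' refEdge e'' → T' = T''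

namespace SurfaceMesh

variable {ι : Type*} {kg : ℕ} (M : SurfaceMesh ι kg)

/-- The element map `Φ_T`. -/
def map (T : ι) : (Fin 2 → ℝ) → (Fin 3 → ℝ) := polyMap (M.poly T)

/-- The closed curved triangle `T = Φ_T(T̂)`; the discrete surface is the union of these. -/
def elem (T : ι) : Set (Fin 3 → ℝ) := M.map T '' refTriangle

/-- The closed edge number `e` of the element `T`. -/
def edge (T : ι) (e : Fin 3) : Set (Fin 3 → ℝ) := M.map T '' refEdge e

/-- The inverse `Φ_T⁻¹` of the element map, on the element `T`. -/
def coord (T : ι) : (Fin 3 → ℝ) → (Fin 2 → ℝ) := Function.invFunOn (M.map T) refTriangle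

/-- The Jacobian `F = Φ_T'`, as a function on the reference triangle. -/
def jac (T : ι) (x : Fin 2 → ℝ) : Matrix (Fin 3) (Fin 2) ℝ := polyJac (M.poly T) x

/-- The functional determinant `J = √(det (Fᵀ F))`, as a function on the reference triangle. -/
def J (T : ι) (x : Fin 2 → ℝ) : ℝ := Real.sqrt ((M.jac T x)ᵀ * M.jac T x).det

/-- A unit normal vector of the element `T` at its point `x`: the normalized cross product of
the two columns of `F`. -/
def normal (T : ι) (x : Fin 3 → ℝ) : Fin 3 → ℝ :=
  unitVec ((M.jac T (M.coord T x)).col 0 ⨯₃ (M.jac T (M.coord T x)).col 1)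

/-- The projection `P = I - n nᵀ` onto the tangent plane of `T` at `x`. -/
def proj (T : ι) (x : Fin 3 → ℝ) : Matrix (Fin 3) (Fin 3) ℝ :=
  1 - Matrix.vecMulVec (M.normal T x) (M.normal T x)

/-- The unit tangent vector at `x` to the edge `e` of `T`. -/
def tangent (T : ι) (e : Fin 3) (x : Fin 3 → ℝ) : Fin 3 → ℝ :=
  unitVec (M.jac T (M.coord T x) *ᵥ refTangent e)

/-- The in-plane unit outer normal `μ` of `T` at the point `x` of its edge `e`. As the tangent
comes from the counterclockwise orientation of the reference triangle and the normal from the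
same element map, the product points out of `T` for every choice of the element map. -/
def conormal (T : ι) (e : Fin 3) (x : Fin 3 → ℝ) : Fin 3 → ℝ :=
  M.tangent T e x ⨯₃ M.normal T x

/-- The surface gradient `∇_Γ v = P (∇vᵖ) P` at the point `x` of the element `T`, for a vector
field `v` given on `T`. The derivative is taken within `T`: it is defined only up to its values
on normal vectors, which the projection `P` on the right removes, so it may be replaced by the
Jacobian matrix of any differentiable extension of `v` to a neighbourhood. -/
def surfGrad (T : ι) (v : (Fin 3 → ℝ) → (Fin 3 → ℝ)) (x : Fin 3 → ℝ) :
    Matrix (Fin 3) (Fin 3) ℝ :=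
  M.proj T x *
    LinearMap.toMatrix' (fderivWithin ℝ v (M.elem T) x : (Fin 3 → ℝ) →ₗ[ℝ] (Fin 3 → ℝ)) *
    M.proj T x

/-- The surface divergence `div_Γ v = tr (∇_Γ v)` at the point `x` of the element `T`. -/
def surfDiv (T : ι) (v : (Fin 3 → ℝ) → (Fin 3 → ℝ)) (x : Fin 3 → ℝ) : ℝ :=
  (M.surfGrad T v x).trace

/-- The surface integral over the discrete surface of a function given on each element. -/
def surfIntegral [Fintype ι] (f : ι → (Fin 3 → ℝ) → ℝ) : ℝ :=
  ∑ T, ∫ x in refTriangle, f T (M.map T x) * M.J T x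

/-- The space `W_h^k` of Piola-mapped piecewise polynomial vector fields. A piecewise field is
given by its restrictions `v T` to the closed elements `T`, hence with its one-sided traces on
the edges (only the values of `v T` on `T` are ever used). Such fields are bounded. -/
def fieldSpace (k : ℕ) : Set (ι → (Fin 3 → ℝ) → (Fin 3 → ℝ)) :=
  {v | ∀ T, ∃ p : Fin 2 → MvPolynomial (Fin 2) ℝ, (∀ j, (p j).totalDegree ≤ k) ∧
    ∀ x ∈ refTriangle,
      v T (M.map T x) = (M.J T x)⁻¹ • (M.jac T x *ᵥ fun j => MvPolynomial.eval x (p j))}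

/-- The normal jump of `v` vanishes on every edge: on an edge common to two elements
`v|_T · μ_T + v|_T' · μ_T' = 0`, on an edge that belongs to one element only `v · μ = 0`. -/
def NormalContinuous (v : ι → (Fin 3 → ℝ) → (Fin 3 → ℝ)) : Prop :=
  (∀ T T' e e', T ≠ T' → M.edge T e = M.edge T' e' → ∀ x ∈ M.edge T e,
    v T x ⬝ᵥ M.conormal T e x + v T' x ⬝ᵥ M.conormal T' e' x = 0) ∧
  (∀ T e, (∀ T' e', T' ≠ T → M.edge T' e' ≠ M.edge T e) → ∀ x ∈ M.edge T e,
    v T x ⬝ᵥ M.conormal T e x = 0)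

/-- The velocity space `V_h^k`: the fields in `W_h^k` with vanishing normal jumps. -/
def velocitySpace (k : ℕ) : Set (ι → (Fin 3 → ℝ) → (Fin 3 → ℝ)) :=
  {v | v ∈ M.fieldSpace k ∧ M.NormalContinuous v}

/-- The pressure space `Q_h^k`: discontinuous mapped piecewise polynomials with mean zero. -/
def pressureSpace [Fintype ι] (k : ℕ) : Set (ι → (Fin 3 → ℝ) → ℝ) :=
  {q | (∀ T, ∃ p : MvPolynomial (Fin 2) ℝ, p.totalDegree ≤ k ∧
      ∀ x ∈ M.elem T, q T x = MvPolynomial.eval (M.coord T x) p) ∧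
    M.surfIntegral q = 0}

/-- The bilinear form `b_h(v, q) = -∫_{Γ_h} div_Γ(v) q`. -/
def bForm [Fintype ι] (v : ι → (Fin 3 → ℝ) → (Fin 3 → ℝ)) (q : ι → (Fin 3 → ℝ) → ℝ) : ℝ :=
  -M.surfIntegral fun T x => M.surfDiv T (v T) x * q T x

end SurfaceMesh

end

noncomputable section

open Set Filter Topology MeasureTheory

/-! On each `T` the field `u` is the Piola transform of a polynomial field `p T`, and `div_Γ u ∘ Φ =
J⁻¹ div p` (`trace_mul_piolaJac`, `surfDiv_of_eq_piola`). Hence `J div_Γ u` is, in reference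
coordinates, a polynomial of degree at most `ku - 1`; subtracting its surface mean `m` gives an
admissible pressure `q`. The weight `J` of the surface integral cancels `J⁻¹`, so `b(u, q) = 0`
reads `∑ ∫ (div p)² = m ∑ ∫ div p`.

The right side is zero: by the divergence theorem (`integral_polyDiv`), `∑ ∫ div p` is a sum of edge
fluxes. Each flux is the line integral of `u · μ` over the curved edge (`refFlux_eq_of_eq_piola`),
whatever the parametrization (`integral_edge_eq`). So shared edges cancel, boundary edges contribute
nothing, and the continuous function `div p` vanishes on every closed reference triangle. -/

/-! ### Inverses of injections on compact sets; reparametrization of line integrals -/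

/-- The inverse of a continuous injection on a compact set is continuous. -/
theorem continuousOn_invFunOn_of_isCompact {X Y : Type*} [TopologicalSpace X] [Nonempty X]
    [TopologicalSpace Y] [T2Space Y] {f : X → Y} {K : Set X} (hK : IsCompact K)
    (hf : ContinuousOn f K) (hinj : InjOn f K) :
    ContinuousOn (Function.invFunOn f K) (f '' K) := by
  rw [continuousOn_iff_isClosed]
  intro t ht
  -- On the image, the preimage of `t` under the inverse is the image of the compact set `K ∩ t`,
  -- which is closed in a Hausdorff space.
  refine ⟨f '' (K ∩ t), ?_, ?_⟩
  · exact ((hK.inter_right ht).image_of_continuousOn (hf.mono inter_subset_left)).isClosed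
  · ext y
    constructor
    · rintro ⟨hy, x, hx, rfl⟩
      refine ⟨⟨x, ⟨hx, ?_⟩, rfl⟩, x, hx, rfl⟩
      simpa [hinj.leftInvOn_invFunOn hx] using hy
    · rintro ⟨⟨x, ⟨hx, hxt⟩, rfl⟩, -⟩
      refine ⟨?_, x, hx, rfl⟩
      simpa [hinj.leftInvOn_invFunOn hx] using hxt

/-- The inverse of a continuous injection on a compact set is differentiable within the image
at the image of every point where the injection has a derivative with a left inverse. -/
theorem hasFDerivWithinAt_invFunOn {E F : Type*} [NormedAddCommGroup E] [NormedSpace ℝ E]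
    [NormedAddCommGroup F] [NormedSpace ℝ F] {f : E → F} {K : Set E} (hK : IsCompact K)
    (hf : ContinuousOn f K) (hinj : InjOn f K) {x : E} (hx : x ∈ K) {f' : E →L[ℝ] F}
    {L : F →L[ℝ] E} (hf' : HasFDerivWithinAt f f' K x) (hL : ∀ v, L (f' v) = v) :
    HasFDerivWithinAt (Function.invFunOn f K) L (f '' K) (f x) := by
  have hc := continuousOn_invFunOn_of_isCompact hK hf hinj
  have hinv : Function.invFunOn f K (f x) = x := hinj.leftInvOn_invFunOn hx
  -- `f'` need not be onto: to first order the image moves only along the range of `f'`, where all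
  -- left inverses agree.
  refine HasFDerivWithinAt.of_comp_of_leftInverse (f := f) (f' := f') (t := K) ?_ ?_
    (hasFDerivWithinAt_id _ _) ?_ ?_ ?_
  · exact tendsto_nhdsWithin_iff.2 ⟨hc (f x) ⟨x, hx, rfl⟩,
      eventually_mem_nhdsWithin.mono fun y hy => (surjOn_image f K).mapsTo_invFunOn hy⟩
  · rwa [hinv]
  · exact eventually_mem_nhdsWithin.mono fun y hy => (surjOn_image f K).rightInvOn_invFunOn hy
  · exact hL
  · exact ⟨x, hx, rfl⟩

/-- The line integral of a function over a curve does not depend on the parametrization. -/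
theorem setIntegral_comp_curve_eq {V : Type*} [NormedAddCommGroup V] [NormedSpace ℝ V]
    {s t : Set ℝ} (hs : MeasurableSet s) (hsu : UniqueDiffOn ℝ s) {γ δ : ℝ → V}
    {γ' δ' : ℝ → V} {ψ ψ' : ℝ → ℝ} (hγ : ∀ r ∈ s, HasDerivWithinAt γ (γ' r) s r)
    (hδ : ∀ r ∈ t, HasDerivWithinAt δ (δ' r) t r)
    (hψ : ∀ r ∈ s, HasDerivWithinAt ψ (ψ' r) s r) (hinj : InjOn γ s) (himg : ψ '' s = t)
    (hδψ : ∀ r ∈ s, δ (ψ r) = γ r) (N : V → ℝ) (hN : ∀ (c : ℝ) v, N (c • v) = |c| * N v)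
    (g : V → ℝ) :
    ∫ r in s, g (γ r) * N (γ' r) = ∫ r in t, g (δ r) * N (δ' r) := by
  have hψinj : InjOn ψ s := fun a ha b hb h => hinj ha hb (by rw [← hδψ a ha, h, hδψ b hb])
  -- This change of variables needs only injectivity, so `ψ'` may vanish; the factor `|ψ'|` is
  -- absorbed by the homogeneity of `N`.
  rw [← himg, integral_image_eq_integral_abs_deriv_smul hs hψ hψinj]
  refine setIntegral_congr_fun hs fun r hr => ?_
  have hmaps : MapsTo ψ s t := himg ▸ mapsTo_image ψ s
  have h1 : HasDerivWithinAt γ (ψ' r • δ' (ψ r)) s r :=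
    ((hδ _ (hmaps hr)).scomp r (hψ r hr) hmaps).congr (fun y hy => (hδψ y hy).symm)
      (hδψ r hr).symm
  have h2 : γ' r = ψ' r • δ' (ψ r) := (hsu r hr).eq_deriv _ (hγ r hr) h1
  simp only [h2, hN, hδψ r hr, smul_eq_mul]
  ring

/-! ### Derivatives of polynomials -/

namespace MvPolynomial

/-- A monomial `m` of the derivative comes from the monomial `m + eᵢ` of `p`. For constant `p` the
truncated `0 - 1 = 0` is the degree of the zero polynomial. -/
theorem totalDegree_pderiv_le {σ R : Type*} [CommSemiring R] (i : σ) (p : MvPolynomial σ R) :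
    (pderiv i p).totalDegree ≤ p.totalDegree - 1 := by
  classical
  refine Finset.sup_le fun m hm => ?_
  have h : m + Finsupp.single i 1 ∈ p.support := by
    rw [mem_support_iff, coeff_pderiv] at hm
    exact mem_support_iff.2 fun h0 => hm (by simp [h0])
  have := le_totalDegree h
  rw [Finsupp.sum_add_index' (by simp) (by simp), Finsupp.sum_single_index rfl] at this
  omega

theorem hasFDerivAt_eval {n : ℕ} (p : MvPolynomial (Fin n) ℝ) (x : Fin n → ℝ) :
    HasFDerivAt (fun y => eval y p)
      (∑ j, eval x (pderiv j p) • ContinuousLinearMap.proj (R := ℝ) (φ := fun _ : Fin n => ℝ) j)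
      x := by
  induction p using MvPolynomial.induction_on with
  | C a => simpa using hasFDerivAt_const a x
  | add p q hp hq =>
    simp only [map_add, add_smul, Finset.sum_add_distrib]
    exact hp.add hq
  | mul_X p k hp =>
    have h := hp.mul (hasFDerivAt_apply (𝕜 := ℝ) k x)
    simp only [map_mul, eval_X]
    refine h.congr_fderiv ?_
    ext v
    simp [pderiv_X, Pi.single_apply, add_mul, Finset.sum_add_distrib, Finset.mul_sum,
      apply_ite]
    ring_nf

end MvPolynomial

/-! ### Geometry of the reference triangle -/

theorem convex_refTriangle : Convex ℝ refTriangle := by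
  rintro x ⟨h1, h2, h3⟩ y ⟨h4, h5, h6⟩ a b ha hb hab
  refine ⟨?_, ?_, ?_⟩ <;> simp only [Pi.add_apply, Pi.smul_apply, smul_eq_mul]
  · positivity
  · positivity
  · nlinarith [mul_le_mul_of_nonneg_left h3 ha, mul_le_mul_of_nonneg_left h6 hb]

theorem isClosed_refTriangle : IsClosed refTriangle := by
  have h0 : IsClosed {x : Fin 2 → ℝ | 0 ≤ x 0} := isClosed_le continuous_const (by fun_prop)
  have h1 : IsClosed {x : Fin 2 → ℝ | 0 ≤ x 1} := isClosed_le continuous_const (by fun_prop)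
  have h2 : IsClosed {x : Fin 2 → ℝ | x 0 + x 1 ≤ 1} := isClosed_le (by fun_prop) continuous_const
  exact h0.inter (h1.inter h2)

theorem isCompact_refTriangle : IsCompact refTriangle := by
  refine (isCompact_Icc (a := (0 : Fin 2 → ℝ)) (b := 1)).of_isClosed_subset
    isClosed_refTriangle fun x ⟨h1, h2, h3⟩ => ⟨fun i => ?_, fun i => ?_⟩ <;>
  fin_cases i <;> simp <;> linarith

theorem nonempty_interior_refTriangle : (interior refTriangle).Nonempty := by
  refine ⟨![1 / 4, 1 / 4], mem_interior.2 ⟨{x | 0 < x 0} ∩ ({x | 0 < x 1} ∩ {x | x 0 + x 1 < 1}),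
    ?_, ?_, ?_⟩⟩
  · rintro x ⟨h1, h2, h3⟩
    exact ⟨h1.le, h2.le, h3.le⟩
  · exact (isOpen_lt continuous_const (by fun_prop)).inter
      ((isOpen_lt continuous_const (by fun_prop)).inter
        (isOpen_lt (by fun_prop) continuous_const))
  · refine ⟨?_, ?_, ?_⟩ <;> norm_num

theorem uniqueDiffOn_refTriangle : UniqueDiffOn ℝ refTriangle :=
  uniqueDiffOn_convex convex_refTriangle nonempty_interior_refTriangle

theorem refTriangle_subset_closure_interior : refTriangle ⊆ closure (interior refTriangle) := by
  rw [convex_refTriangle.closure_interior_eq_closure_of_nonempty_interior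
    nonempty_interior_refTriangle]
  exact subset_closure

/-- The affine parametrization of the edge `e` of the reference triangle over `[0, 1]`. -/
def refCurve (e : Fin 3) (s : ℝ) : Fin 2 → ℝ := refVertex e + s • refTangent e

theorem refCurve_image (e : Fin 3) : refCurve e '' Icc 0 1 = refEdge e :=
  (segment_eq_image' ℝ _ _).symm

theorem refVertex_mem (e : Fin 3) : refVertex e ∈ refTriangle := by
  fin_cases e <;> refine ⟨?_, ?_, ?_⟩ <;> simp [refVertex]

theorem refEdge_subset (e : Fin 3) : refEdge e ⊆ refTriangle :=
  convex_refTriangle.segment_subset (refVertex_mem _) (refVertex_mem _)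

theorem refCurve_mem (e : Fin 3) {s : ℝ} (hs : s ∈ Icc (0 : ℝ) 1) : refCurve e s ∈ refTriangle :=
  refEdge_subset e (refCurve_image e ▸ mem_image_of_mem _ hs)

theorem hasDerivAt_refCurve (e : Fin 3) (s : ℝ) :
    HasDerivAt (refCurve e) (refTangent e) s := by
  have h := ((hasDerivAt_id s).smul_const (refTangent e)).const_add (refVertex e)
  rwa [one_smul] at h

theorem refTangent_zero : refTangent 0 = ![1, 0] := by
  ext i; fin_cases i <;> simp [refTangent, refVertex]

theorem refTangent_one : refTangent 1 = ![-1, 1] := by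
  ext i; fin_cases i <;> simp [refTangent, refVertex]

theorem refTangent_two : refTangent 2 = ![0, -1] := by
  ext i; fin_cases i <;> simp [refTangent, refVertex]

theorem refCurve_zero (s : ℝ) : refCurve 0 s = ![s, 0] := by
  ext i; fin_cases i <;> simp [refCurve, refTangent, refVertex]

theorem refCurve_one (s : ℝ) : refCurve 1 s = ![1 - s, s] := by
  ext i; fin_cases i <;> simp [refCurve, refTangent, refVertex]; ring

theorem refCurve_two (s : ℝ) : refCurve 2 s = ![0, 1 - s] := by
  ext i; fin_cases i <;> simp [refCurve, refTangent, refVertex]; ring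

theorem refTangent_dotProduct_self_pos (e : Fin 3) : 0 < refTangent e ⬝ᵥ refTangent e := by
  obtain rfl | rfl | rfl : e = 0 ∨ e = 1 ∨ e = 2 := by revert e; decide
  · norm_num [refTangent_zero, dotProduct, Fin.sum_univ_two]
  · norm_num [refTangent_one, dotProduct, Fin.sum_univ_two]
  · norm_num [refTangent_two, dotProduct, Fin.sum_univ_two]

theorem refTangent_ne_zero (e : Fin 3) : refTangent e ≠ 0 := fun h => by
  simpa [h] using refTangent_dotProduct_self_pos e

/-- The parameter on the edge `e` of the reference triangle, extended to the plane. -/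
def refParam (e : Fin 3) (x : Fin 2 → ℝ) : ℝ :=
  (refTangent e ⬝ᵥ refTangent e)⁻¹ * (refTangent e ⬝ᵥ (x - refVertex e))

theorem refParam_refCurve (e : Fin 3) (s : ℝ) : refParam e (refCurve e s) = s := by
  have := (refTangent_dotProduct_self_pos e).ne'
  simp only [refParam, refCurve, add_sub_cancel_left, dotProduct_smul, smul_eq_mul]
  field_simp

theorem refCurve_injective (e : Fin 3) : Function.Injective (refCurve e) :=
  Function.LeftInverse.injective (refParam_refCurve e)

theorem differentiable_refParam (e : Fin 3) : Differentiable ℝ (refParam e) := by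
  unfold refParam
  simp only [dotProduct, Fin.sum_univ_two, Pi.sub_apply]
  fun_prop

theorem refVertex_add_two_notMem (e : Fin 3) : refVertex (e + 2) ∉ refEdge e := by
  rw [← refCurve_image]
  rintro ⟨s, -, hs⟩
  have h0 := congrFun hs 0
  have h1 := congrFun hs 1
  fin_cases e <;> simp [refCurve, refTangent, refVertex] at h0 h1
  linarith

/-- The vertex `e + 2` opposite to edge `e` lies on both other edges. -/
theorem refEdge_injective : Function.Injective refEdge := by
  intro e e' h
  by_contra hne
  apply refVertex_add_two_notMem e
  have key : ∀ a b : Fin 3, a ≠ b → a + 2 = b ∨ a + 2 = b + 1 := by decide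
  rw [h]
  rcases key e e' hne with h | h <;> rw [h]
  · exact left_mem_segment _ _ _
  · exact right_mem_segment _ _ _

/-! ### Fubini and the divergence theorem on the reference triangle -/

theorem setIntegral_refTriangle_eq_prod (f : (Fin 2 → ℝ) → ℝ) :
    ∫ x in refTriangle, f x =
      ∫ z : ℝ × ℝ, indicator refTriangle f ![z.1, z.2] := by
  rw [← integral_indicator isClosed_refTriangle.measurableSet]
  exact ((volume_preserving_finTwoArrow ℝ).symm.integral_comp'
    (indicator refTriangle f)).symm

theorem integrable_indicator_refTriangle {f : (Fin 2 → ℝ) → ℝ} (hf : Continuous f) :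
    Integrable fun z : ℝ × ℝ => indicator refTriangle f ![z.1, z.2] :=
  ((volume_preserving_finTwoArrow ℝ).symm.integrable_comp_emb
    (MeasurableEquiv.measurableEmbedding _)).2
    ((integrable_indicator_iff isClosed_refTriangle.measurableSet).2
      (hf.continuousOn.integrableOn_compact isCompact_refTriangle))

/-- Iterated integral of the indicator of a subgraph triangle. -/
theorem integral_integral_triangle {g : ℝ → ℝ → ℝ} {h : ℝ → ℝ → ℝ}
    (hg : ∀ x y, 0 ≤ x → 0 ≤ y → x + y ≤ 1 → g x y = h x y)
    (hg' : ∀ x y, ¬ (0 ≤ x ∧ 0 ≤ y ∧ x + y ≤ 1) → g x y = 0) :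
    ∫ x, ∫ y, g x y = ∫ x in (0 : ℝ)..1, ∫ y in (0 : ℝ)..(1 - x), h x y := by
  rw [intervalIntegral.integral_of_le zero_le_one, ← integral_Icc_eq_integral_Ioc,
    ← integral_indicator measurableSet_Icc]
  congr 1
  ext x
  by_cases hx : x ∈ Icc (0 : ℝ) 1
  · rw [indicator_of_mem hx, intervalIntegral.integral_of_le (by linarith [hx.2]),
      ← integral_Icc_eq_integral_Ioc, ← integral_indicator measurableSet_Icc]
    congr 1
    ext y
    by_cases hy : y ∈ Icc (0 : ℝ) (1 - x)
    · rw [indicator_of_mem hy]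
      exact hg _ _ hx.1 hy.1 (by linarith [hy.2])
    · rw [indicator_of_notMem hy]
      exact hg' _ _ fun h => hy ⟨h.2.1, by linarith⟩
  · rw [indicator_of_notMem hx]
    refine integral_eq_zero_of_ae (.of_forall fun y => hg' _ _ fun h => hx ⟨h.1, by linarith⟩)

/-- Both orders of integration are needed: each partial derivative is integrated first in its own
variable. -/
theorem setIntegral_refTriangle {f : (Fin 2 → ℝ) → ℝ} (hf : Continuous f) :
    ∫ x in refTriangle, f x = ∫ x in (0 : ℝ)..1, ∫ y in (0 : ℝ)..(1 - x), f ![x, y] := by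
  rw [setIntegral_refTriangle_eq_prod]
  refine (integral_prod _ (integrable_indicator_refTriangle hf)).trans ?_
  refine integral_integral_triangle (fun x y h1 h2 h3 => indicator_of_mem ?_ _)
    fun x y h => indicator_of_notMem ?_ _
  · exact ⟨h1, h2, h3⟩
  · exact h

theorem setIntegral_refTriangle' {f : (Fin 2 → ℝ) → ℝ} (hf : Continuous f) :
    ∫ x in refTriangle, f x = ∫ y in (0 : ℝ)..1, ∫ x in (0 : ℝ)..(1 - y), f ![x, y] := by
  rw [setIntegral_refTriangle_eq_prod]
  refine (integral_prod_symm _ (integrable_indicator_refTriangle hf)).trans ?_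
  refine integral_integral_triangle (fun x y h1 h2 h3 => indicator_of_mem ?_ _)
    fun x y h => indicator_of_notMem ?_ _
  · exact ⟨h2, h1, by simpa [add_comm] using h3⟩
  · exact fun h' => h ⟨h'.2.1, h'.1, by simpa [add_comm] using h'.2.2⟩

section

open MvPolynomial

theorem hasDerivAt_eval_fst (p : MvPolynomial (Fin 2) ℝ) (x y : ℝ) :
    HasDerivAt (fun x => eval ![x, y] p) (eval ![x, y] (pderiv 0 p)) x := by
  have h : HasDerivAt (fun x : ℝ => (![x, y] : Fin 2 → ℝ)) ![1, 0] x := by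
    rw [hasDerivAt_pi]
    intro i
    fin_cases i
    · exact hasDerivAt_id x
    · exact hasDerivAt_const x y
  simpa [Fin.sum_univ_two, Function.comp_def] using (hasFDerivAt_eval p ![x, y]).comp_hasDerivAt x h

theorem hasDerivAt_eval_snd (p : MvPolynomial (Fin 2) ℝ) (x y : ℝ) :
    HasDerivAt (fun y => eval ![x, y] p) (eval ![x, y] (pderiv 1 p)) y := by
  have h : HasDerivAt (fun y : ℝ => (![x, y] : Fin 2 → ℝ)) ![0, 1] y := by
    rw [hasDerivAt_pi]
    intro i
    fin_cases i
    · exact hasDerivAt_const y x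
    · exact hasDerivAt_id y
  simpa [Fin.sum_univ_two, Function.comp_def] using (hasFDerivAt_eval p ![x, y]).comp_hasDerivAt y h

theorem integral_pderiv_zero (p : MvPolynomial (Fin 2) ℝ) :
    ∫ x in refTriangle, eval x (pderiv 0 p) =
      (∫ s in (0 : ℝ)..1, eval ![1 - s, s] p) - ∫ s in (0 : ℝ)..1, eval ![0, s] p := by
  rw [setIntegral_refTriangle' (continuous_eval _), ← intervalIntegral.integral_sub]
  · refine intervalIntegral.integral_congr fun y _ => ?_
    refine intervalIntegral.integral_eq_sub_of_hasDerivAt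
      (fun x _ => hasDerivAt_eval_fst p x y) (Continuous.intervalIntegrable ?_ _ _)
    exact (continuous_eval _).comp (by fun_prop)
  all_goals
    exact ((continuous_eval _).comp (by fun_prop)).intervalIntegrable _ _

theorem integral_pderiv_one (p : MvPolynomial (Fin 2) ℝ) :
    ∫ x in refTriangle, eval x (pderiv 1 p) =
      (∫ s in (0 : ℝ)..1, eval ![s, 1 - s] p) - ∫ s in (0 : ℝ)..1, eval ![s, 0] p := by
  rw [setIntegral_refTriangle (continuous_eval _), ← intervalIntegral.integral_sub]
  · refine intervalIntegral.integral_congr fun x _ => ?_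
    refine intervalIntegral.integral_eq_sub_of_hasDerivAt
      (fun y _ => hasDerivAt_eval_snd p x y) (Continuous.intervalIntegrable ?_ _ _)
    exact (continuous_eval _).comp (by fun_prop)
  all_goals
    exact ((continuous_eval _).comp (by fun_prop)).intervalIntegrable _ _

/-- The divergence of a polynomial vector field on the reference triangle. -/
def polyDiv (p : Fin 2 → MvPolynomial (Fin 2) ℝ) : MvPolynomial (Fin 2) ℝ :=
  pderiv 0 (p 0) + pderiv 1 (p 1)

/-- The flux of a polynomial vector field out of the reference triangle through the edge `e`. -/
def refFlux (p : Fin 2 → MvPolynomial (Fin 2) ℝ) (e : Fin 3) : ℝ :=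
  ∫ s in Icc (0 : ℝ) 1,
    (eval (refCurve e s) (p 0) * refTangent e 1 - eval (refCurve e s) (p 1) * refTangent e 0)

/-- The divergence theorem on the reference triangle. -/
theorem integral_polyDiv (p : Fin 2 → MvPolynomial (Fin 2) ℝ) :
    ∫ x in refTriangle, eval x (polyDiv p) = ∑ e, refFlux p e := by
  have hI : ∀ q : MvPolynomial (Fin 2) ℝ, IntegrableOn (fun x => eval x q) refTriangle :=
    fun q => (continuous_eval q).continuousOn.integrableOn_compact isCompact_refTriangle
  have hc : ∀ (q : MvPolynomial (Fin 2) ℝ) (a : ℝ → Fin 2 → ℝ), Continuous a →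
      IntervalIntegrable (fun s => eval (a s) q) volume 0 1 :=
    fun q a ha => ((continuous_eval q).comp ha).intervalIntegrable _ _
  simp only [polyDiv, map_add]
  rw [integral_add (hI _) (hI _), integral_pderiv_zero, integral_pderiv_one]
  simp only [Fin.sum_univ_three, refFlux, integral_Icc_eq_integral_Ioc,
    ← intervalIntegral.integral_of_le (zero_le_one' ℝ), refCurve_zero, refCurve_one,
    refCurve_two, refTangent_zero, refTangent_one, refTangent_two]
  simp only [Matrix.cons_val_zero, Matrix.cons_val_one, mul_zero, mul_one, mul_neg,
    zero_sub, sub_zero, sub_neg_eq_add, intervalIntegral.integral_neg]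
  rw [intervalIntegral.integral_add (hc _ _ (by fun_prop)) (hc _ _ (by fun_prop))]
  -- The reflection `s ↦ 1 - s` accounts for edge 2 running downwards and for the hypotenuse being
  -- parametrized by `x` in one formula and by `y` in the other.
  have e1 := intervalIntegral.integral_comp_sub_left (a := 0) (b := 1)
    (fun s => eval ![0, s] (p 0)) (1 : ℝ)
  have e2 := intervalIntegral.integral_comp_sub_left (a := 0) (b := 1)
    (fun s => eval ![s, 1 - s] (p 1)) (1 : ℝ)
  simp only [sub_self, sub_zero, sub_sub_cancel] at e1 e2
  rw [e1, e2]
  ring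

end

/-! ### Calculus and matrix algebra behind the Piola transform -/

/-- The commutator of two derivations is a derivation, and this one kills the variables. -/
theorem MvPolynomial.pderiv_pderiv_comm {σ R : Type*} [CommRing R] (i j : σ)
    (p : MvPolynomial σ R) : pderiv i (pderiv j p) = pderiv j (pderiv i p) := by
  classical
  have h : ⁅(pderiv i : Derivation R (MvPolynomial σ R) (MvPolynomial σ R)), pderiv j⁆ = 0 :=
    derivation_ext fun k => by
      rw [Derivation.commutator_apply]
      simp [pderiv_X, Pi.single_apply, apply_ite]
  have h' := congrArg (fun D => D p) h
  rw [Derivation.commutator_apply] at h'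
  exact sub_eq_zero.1 h'

/-- With `g^(-1/2)` factored out the rest is rational in `g`, so later identities reduce to
polynomial ones. -/
theorem MvPolynomial.hasFDerivAt_inv_sqrt_mul {n : ℕ} (g N : MvPolynomial (Fin n) ℝ)
    {x : Fin n → ℝ} (hx : 0 < eval x g) :
    HasFDerivAt (fun y => (√(eval y g))⁻¹ * eval y N)
      (∑ j, ((√(eval x g))⁻¹ * (eval x (pderiv j N) -
        (eval x g)⁻¹ * (eval x (pderiv j g) / 2) * eval x N)) •
        ContinuousLinearMap.proj (R := ℝ) (φ := fun _ : Fin n => ℝ) j) x := by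
  have hs := Real.sqrt_pos.2 hx
  have h := ((hasDerivAt_inv hs.ne').comp_hasFDerivAt x
    ((hasFDerivAt_eval g x).sqrt hx.ne')).mul (hasFDerivAt_eval N x)
  refine h.congr_fderiv ?_
  ext v
  have h2 := Real.sq_sqrt hx.le
  simp only [Function.comp_apply, _root_.add_apply, _root_.smul_apply, _root_.sum_apply,
    ContinuousLinearMap.proj_apply, smul_eq_mul, Finset.mul_sum,
    ← Finset.sum_add_distrib]
  refine Finset.sum_congr rfl fun j _ => ?_
  rw [← h2, Real.sqrt_sq hs.le]
  field_simp
  ring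

theorem hasFDerivAt_polyMap (p : Fin 3 → MvPolynomial (Fin 2) ℝ) (x : Fin 2 → ℝ) :
    HasFDerivAt (polyMap p) (Matrix.toLin' (polyJac p x)).toContinuousLinearMap x := by
  refine hasFDerivAt_pi'' fun i => (MvPolynomial.hasFDerivAt_eval (p i) x).congr_fderiv ?_
  ext v
  simp [polyJac, Matrix.mulVec, dotProduct]

theorem continuous_polyMap (p : Fin 3 → MvPolynomial (Fin 2) ℝ) : Continuous (polyMap p) :=
  continuous_pi fun i => MvPolynomial.continuous_eval (p i)

namespace Matrix

variable (F : Matrix (Fin 3) (Fin 2) ℝ)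

/-- Lagrange's identity: `J` is the length of the cross product normalized in `normal`. -/
theorem det_transpose_mul_self_eq :
    (Fᵀ * F).det = (F.col 0 ⨯₃ F.col 1) ⬝ᵥ (F.col 0 ⨯₃ F.col 1) := by
  simp [det_fin_two, mul_apply, Fin.sum_univ_three, cross_apply, dotProduct, col]
  ring

theorem det_transpose_mul_self_pos {F : Matrix (Fin 3) (Fin 2) ℝ} (hF : F.rank = 2) :
    0 < (Fᵀ * F).det := by
  have h0 : 0 ≤ (Fᵀ * F).det := by
    rw [det_transpose_mul_self_eq]
    exact Finset.sum_nonneg fun i _ => mul_self_nonneg _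
  refine lt_of_le_of_ne h0 fun h => ?_
  have hr : (Fᵀ * F).rank = 2 := by rw [rank_transpose_mul_self, hF]
  obtain ⟨v, hv, hv0⟩ := exists_mulVec_eq_zero_iff.2 h.symm
  have hk := LinearMap.finrank_range_add_finrank_ker (Fᵀ * F).mulVecLin
  rw [← rank, hr, Module.finrank_fin_fun, Nat.add_eq_left, Submodule.finrank_eq_zero] at hk
  have hm : v ∈ LinearMap.ker (Fᵀ * F).mulVecLin := hv0
  rw [hk] at hm
  exact hv hm

theorem transpose_mul_self_inv_mul (hF : 0 < (Fᵀ * F).det) : ((Fᵀ * F)⁻¹ * Fᵀ) * F = 1 := by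
  rw [Matrix.mul_assoc, nonsing_inv_mul _ (isUnit_iff_ne_zero.2 hF.ne')]

/-- Both sides are the orthogonal projection onto the column space of `F`. Multiplying by the
determinant leaves polynomial identities in the entries. -/
theorem mul_transpose_mul_self_inv (hF : 0 < (Fᵀ * F).det) :
    F * ((Fᵀ * F)⁻¹ * Fᵀ) = 1 - vecMulVec (unitVec (F.col 0 ⨯₃ F.col 1))
      (unitVec (F.col 0 ⨯₃ F.col 1)) := by
  have hs := Real.sq_sqrt hF.le
  have hs0 := Real.sqrt_pos.2 hF
  have key : ((Fᵀ * F).det) • vecMulVec (unitVec (F.col 0 ⨯₃ F.col 1))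
      (unitVec (F.col 0 ⨯₃ F.col 1)) = vecMulVec (F.col 0 ⨯₃ F.col 1) (F.col 0 ⨯₃ F.col 1) := by
    rw [unitVec, ← det_transpose_mul_self_eq, smul_vecMulVec, vecMulVec_smul, smul_smul, smul_smul]
    nth_rewrite 1 [← hs]
    rw [show √(Fᵀ * F).det ^ 2 * (√(Fᵀ * F).det)⁻¹ * (√(Fᵀ * F).det)⁻¹ = 1 by field_simp, one_smul]
  have h2 : (Fᵀ * F).det • (F * ((Fᵀ * F)⁻¹ * Fᵀ)) = (Fᵀ * F).det • (1 : Matrix _ _ ℝ) -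
      vecMulVec (F.col 0 ⨯₃ F.col 1) (F.col 0 ⨯₃ F.col 1) := by
    rw [inv_def, Ring.inverse_eq_inv', Matrix.smul_mul, Matrix.mul_smul, smul_smul,
      mul_inv_cancel₀ hF.ne', one_smul]
    ext i j
    fin_cases i <;> fin_cases j <;>
    simp [det_fin_two, adjugate_fin_two, mul_apply, vecMul, dotProduct, Fin.sum_univ_three,
      Fin.sum_univ_two, cross_apply, col] <;> ring
  rw [← key, ← smul_sub] at h2
  exact smul_right_injective _ hF.ne' h2

/-- The flux density of the Piola transform of `p` across the direction `t`. -/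
theorem piola_dotProduct_conormal {F : Matrix (Fin 3) (Fin 2) ℝ} (hF : 0 < (Fᵀ * F).det)
    (p t : Fin 2 → ℝ) (ht : t ≠ 0) :
    (((√(Fᵀ * F).det)⁻¹ • (F *ᵥ p)) ⬝ᵥ
      (unitVec (F *ᵥ t) ⨯₃ unitVec (F.col 0 ⨯₃ F.col 1))) * √((F *ᵥ t) ⬝ᵥ (F *ᵥ t)) =
      p 0 * t 1 - p 1 * t 0 := by
  have hs := Real.sq_sqrt hF.le
  have hs0 := Real.sqrt_pos.2 hF
  have hFt : F *ᵥ t ≠ 0 := fun h => ht <| by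
    rw [← one_mulVec t, ← F.transpose_mul_self_inv_mul hF, ← mulVec_mulVec, h, mulVec_zero]
  have hl : 0 < √((F *ᵥ t) ⬝ᵥ (F *ᵥ t)) := Real.sqrt_pos.2 <|
    lt_of_le_of_ne (Finset.sum_nonneg fun i _ => mul_self_nonneg _)
      fun h => hFt (dotProduct_self_eq_zero.1 h.symm)
  -- The determinant is `J²`: one `J` cancels the Piola factor, the other the length of the normal;
  -- the arc length factor cancels the length of the tangent.
  have key : (F *ᵥ p) ⬝ᵥ ((F *ᵥ t) ⨯₃ (F.col 0 ⨯₃ F.col 1)) =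
      (Fᵀ * F).det * (p 0 * t 1 - p 1 * t 0) := by
    simp [det_fin_two, mul_apply, Fin.sum_univ_three, Fin.sum_univ_two, cross_apply, dotProduct,
      mulVec, col]
    ring
  simp only [unitVec, ← det_transpose_mul_self_eq, map_smul, LinearMap.smul_apply,
    smul_dotProduct, dotProduct_smul, smul_eq_mul, key]
  generalize √((F *ᵥ t) ⬝ᵥ (F *ᵥ t)) = l at hl
  rw [← hs, Real.sqrt_sq hs0.le]
  field_simp

end Matrix

/-! ### The Piola transform and its divergence -/

/-- The polynomial `det (Fᵀ F)` of a polynomial map with Jacobian `F`. -/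
def gramPoly (p : Fin 3 → MvPolynomial (Fin 2) ℝ) : MvPolynomial (Fin 2) ℝ :=
  (∑ i, MvPolynomial.pderiv 0 (p i) * MvPolynomial.pderiv 0 (p i)) *
    (∑ i, MvPolynomial.pderiv 1 (p i) * MvPolynomial.pderiv 1 (p i)) -
  (∑ i, MvPolynomial.pderiv 0 (p i) * MvPolynomial.pderiv 1 (p i)) ^ 2

theorem eval_gramPoly (p : Fin 3 → MvPolynomial (Fin 2) ℝ) (x : Fin 2 → ℝ) :
    MvPolynomial.eval x (gramPoly p) = ((polyJac p x)ᵀ * polyJac p x).det := by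
  simp [gramPoly, polyJac, Matrix.det_fin_two, Matrix.mul_apply, Fin.sum_univ_three]
  ring

/-- The unscaled Piola transform `F q` of a polynomial field, as a vector of polynomials. -/
def piolaPoly (p : Fin 3 → MvPolynomial (Fin 2) ℝ) (q : Fin 2 → MvPolynomial (Fin 2) ℝ)
    (i : Fin 3) : MvPolynomial (Fin 2) ℝ :=
  ∑ j, MvPolynomial.pderiv j (p i) * q j

/-- The Piola transform `J⁻¹ F q` of a polynomial field. -/
def piola (p : Fin 3 → MvPolynomial (Fin 2) ℝ) (q : Fin 2 → MvPolynomial (Fin 2) ℝ)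
    (x : Fin 2 → ℝ) : Fin 3 → ℝ :=
  (√((polyJac p x)ᵀ * polyJac p x).det)⁻¹ • (polyJac p x *ᵥ fun j => MvPolynomial.eval x (q j))

/-- The Jacobian matrix of `piola p q`. -/
def piolaJac (p : Fin 3 → MvPolynomial (Fin 2) ℝ) (q : Fin 2 → MvPolynomial (Fin 2) ℝ)
    (x : Fin 2 → ℝ) : Matrix (Fin 3) (Fin 2) ℝ :=
  Matrix.of fun i j => (√((polyJac p x)ᵀ * polyJac p x).det)⁻¹ *
    (MvPolynomial.eval x (MvPolynomial.pderiv j (piolaPoly p q i)) -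
      ((polyJac p x)ᵀ * polyJac p x).det⁻¹ *
        (MvPolynomial.eval x (MvPolynomial.pderiv j (gramPoly p)) / 2) *
        MvPolynomial.eval x (piolaPoly p q i))

theorem hasFDerivAt_piola (p : Fin 3 → MvPolynomial (Fin 2) ℝ)
    (q : Fin 2 → MvPolynomial (Fin 2) ℝ) {x : Fin 2 → ℝ}
    (hx : 0 < ((polyJac p x)ᵀ * polyJac p x).det) :
    HasFDerivAt (piola p q) (Matrix.toLin' (piolaJac p q x)).toContinuousLinearMap x := by
  refine hasFDerivAt_pi'' fun i => ?_
  rw [← eval_gramPoly] at hx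
  have h := MvPolynomial.hasFDerivAt_inv_sqrt_mul (gramPoly p) (piolaPoly p q i) hx
  refine (h.congr_fderiv ?_).congr_of_eventuallyEq (.of_forall fun y => ?_)
  · ext v
    simp [piolaJac, Matrix.mulVec, dotProduct, eval_gramPoly]
  · simp [piola, piolaPoly, polyJac, Matrix.mulVec, dotProduct, eval_gramPoly]

/-- The divergence of the Piola transform is `J⁻¹` times the divergence. -/
theorem trace_mul_piolaJac (p : Fin 3 → MvPolynomial (Fin 2) ℝ)
    (q : Fin 2 → MvPolynomial (Fin 2) ℝ) {x : Fin 2 → ℝ}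
    (hx : 0 < ((polyJac p x)ᵀ * polyJac p x).det) :
    ((((polyJac p x)ᵀ * polyJac p x)⁻¹ * (polyJac p x)ᵀ) * piolaJac p q x).trace =
      (√((polyJac p x)ᵀ * polyJac p x).det)⁻¹ * MvPolynomial.eval x (polyDiv q) := by
  rw [Matrix.inv_def, Ring.inverse_eq_inv', Matrix.smul_mul, Matrix.smul_mul, Matrix.trace_smul]
  have hg : ((polyJac p x)ᵀ * polyJac p x).det = MvPolynomial.eval x (gramPoly p) :=
    (eval_gramPoly p x).symm
  have hcomm : ∀ i, MvPolynomial.pderiv 1 (MvPolynomial.pderiv 0 (p i)) =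
    MvPolynomial.pderiv 0 (MvPolynomial.pderiv 1 (p i)) := fun i =>
      MvPolynomial.pderiv_pderiv_comm _ _ _
  have key : MvPolynomial.eval x (gramPoly p) * (∑ j, ∑ i,
      (((polyJac p x)ᵀ * polyJac p x).adjugate * (polyJac p x)ᵀ) j i *
        MvPolynomial.eval x (MvPolynomial.pderiv j (piolaPoly p q i))) -
      ∑ j, (MvPolynomial.eval x (MvPolynomial.pderiv j (gramPoly p)) / 2) * ∑ i,
        (((polyJac p x)ᵀ * polyJac p x).adjugate * (polyJac p x)ᵀ) j i *
        MvPolynomial.eval x (piolaPoly p q i) =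
      MvPolynomial.eval x (gramPoly p) ^ 2 * MvPolynomial.eval x (polyDiv q) := by
    -- The pseudo-inverse of `F` recovers `q` from `F q`; the adjugate in place of the inverse
    -- leaves the factor `det (Fᵀ F)`.
    have hq : ∀ j, ∑ i, (((polyJac p x)ᵀ * polyJac p x).adjugate * (polyJac p x)ᵀ) j i *
        MvPolynomial.eval x (piolaPoly p q i) =
          MvPolynomial.eval x (gramPoly p) * MvPolynomial.eval x (q j) := by
      intro j
      fin_cases j <;>
      simp [gramPoly, polyJac, Matrix.adjugate_fin_two, Matrix.mul_apply, Fin.sum_univ_three,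
        Fin.sum_univ_two, piolaPoly] <;> ring
    simp only [hq]
    rw [pow_two, mul_assoc]
    simp only [mul_left_comm _ (MvPolynomial.eval x (gramPoly p)), ← Finset.mul_sum, ← mul_sub]
    congr 1
    -- In the product rule the derivatives of `q` yield `g div q`, with `g` the Gram determinant.
    -- The second derivatives of the map, symmetric by `hcomm`, yield `∇g · q / 2` by Jacobi's
    -- formula and cancel.
    simp [gramPoly, polyJac, Matrix.adjugate_fin_two, Matrix.mul_apply, Fin.sum_univ_three,
      Fin.sum_univ_two, piolaPoly, hcomm, polyDiv]
    ring
  rw [← hg] at key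
  have hs := Real.sqrt_pos.2 hx
  generalize ((polyJac p x)ᵀ * polyJac p x).adjugate * (polyJac p x)ᵀ = A at key ⊢
  have e : (A * piolaJac p q x).trace =
    (√((polyJac p x)ᵀ * polyJac p x).det)⁻¹ * (((polyJac p x)ᵀ * polyJac p x).det⁻¹ *
      (((polyJac p x)ᵀ * polyJac p x).det ^ 2 * MvPolynomial.eval x (polyDiv q))) := by
    rw [← key]
    simp only [Matrix.trace, Matrix.diag, Matrix.mul_apply, piolaJac, Matrix.of_apply]
    generalize ((polyJac p x)ᵀ * polyJac p x).det = g at *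
    simp only [Fin.sum_univ_three, Fin.sum_univ_two]
    field_simp
    ring
  rw [e, smul_eq_mul]
  field_simp

/-! ### Transfer to the curved elements -/

namespace SurfaceMesh

variable {ι : Type*} {kg : ℕ} (M : SurfaceMesh ι kg)

theorem coord_map (T : ι) {x : Fin 2 → ℝ} (hx : x ∈ refTriangle) :
    M.coord T (M.map T x) = x :=
  (M.injOn T).leftInvOn_invFunOn hx

theorem gram_pos (T : ι) {x : Fin 2 → ℝ} (hx : x ∈ refTriangle) :
    0 < ((M.jac T x)ᵀ * M.jac T x).det :=
  Matrix.det_transpose_mul_self_pos (M.rank_eq T x hx)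

theorem J_pos (T : ι) {x : Fin 2 → ℝ} (hx : x ∈ refTriangle) : 0 < M.J T x :=
  Real.sqrt_pos.2 (M.gram_pos T hx)

theorem continuous_J (T : ι) : Continuous (M.J T) := by
  have h : M.J T = fun x => √(MvPolynomial.eval x (gramPoly (M.poly T))) := by
    ext x
    rw [eval_gramPoly]
    rfl
  rw [h]
  exact (MvPolynomial.continuous_eval _).sqrt

theorem hasFDerivAt_map (T : ι) (x : Fin 2 → ℝ) :
    HasFDerivAt (M.map T) (Matrix.toLin' (M.jac T x)).toContinuousLinearMap x :=
  hasFDerivAt_polyMap _ _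

theorem hasFDerivWithinAt_coord (T : ι) {x : Fin 2 → ℝ} (hx : x ∈ refTriangle) :
    HasFDerivWithinAt (M.coord T)
      (Matrix.toLin' (((M.jac T x)ᵀ * M.jac T x)⁻¹ * (M.jac T x)ᵀ)).toContinuousLinearMap
      (M.elem T) (M.map T x) := by
  refine hasFDerivWithinAt_invFunOn isCompact_refTriangle (continuous_polyMap _).continuousOn
    (M.injOn T) hx (M.hasFDerivAt_map T x).hasFDerivWithinAt fun v => ?_
  simp only [LinearMap.coe_toContinuousLinearMap', Matrix.toLin'_apply, Matrix.mulVec_mulVec]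
  rw [Matrix.transpose_mul_self_inv_mul _ (M.gram_pos T hx), Matrix.one_mulVec]

theorem proj_map (T : ι) {x : Fin 2 → ℝ} (hx : x ∈ refTriangle) :
    M.proj T (M.map T x) =
      M.jac T x * (((M.jac T x)ᵀ * M.jac T x)⁻¹ * (M.jac T x)ᵀ) := by
  rw [Matrix.mul_transpose_mul_self_inv _ (M.gram_pos T hx), proj, normal, M.coord_map T hx]

section Piola

variable {T : ι} {v : (Fin 3 → ℝ) → (Fin 3 → ℝ)} {p : Fin 2 → MvPolynomial (Fin 2) ℝ}

theorem differentiableWithinAt_of_eq_piola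
    (hv : ∀ x ∈ refTriangle, v (M.map T x) = piola (M.poly T) p x)
    {x : Fin 2 → ℝ} (hx : x ∈ refTriangle) :
    DifferentiableWithinAt ℝ v (M.elem T) (M.map T x) := by
  have h1 : DifferentiableAt ℝ (piola (M.poly T) p) (M.coord T (M.map T x)) := by
    rw [M.coord_map T hx]
    exact (hasFDerivAt_piola _ p (M.gram_pos T hx)).differentiableAt
  refine (h1.comp_differentiableWithinAt _
    (M.hasFDerivWithinAt_coord T hx).differentiableWithinAt).congr ?_ ?_
  · rintro _ ⟨y, hy, rfl⟩
    rw [Function.comp_apply, M.coord_map T hy, hv y hy]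
  · rw [Function.comp_apply, M.coord_map T hx, hv x hx]

/-- With `L = (FᵀF)⁻¹Fᵀ` and `B` the derivative within `T`, `P = F L` and `L F = 1` give `tr (P B P)
= tr (L B F)`. Only `B F` enters, and the chain rule determines it. -/
theorem surfDiv_of_eq_piola
    (hv : ∀ x ∈ refTriangle, v (M.map T x) = piola (M.poly T) p x)
    {x : Fin 2 → ℝ} (hx : x ∈ refTriangle) :
    M.surfDiv T v (M.map T x) = (M.J T x)⁻¹ * MvPolynomial.eval x (polyDiv p) := by
  have hA := (M.differentiableWithinAt_of_eq_piola hv hx).hasFDerivWithinAt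
  have hmaps : MapsTo (M.map T) refTriangle (M.elem T) := mapsTo_image _ _
  have h1 := hA.comp x (M.hasFDerivAt_map T x).hasFDerivWithinAt hmaps
  have h2 : HasFDerivWithinAt (v ∘ M.map T)
      (Matrix.toLin' (piolaJac (M.poly T) p x)).toContinuousLinearMap refTriangle x :=
    (hasFDerivAt_piola _ p (M.gram_pos T hx)).hasFDerivWithinAt.congr hv (hv x hx)
  -- Derivatives are compared on the reference triangle, where they are unique; within the surface
  -- `T` in `ℝ³` they are not.
  have h3 := (uniqueDiffOn_refTriangle x hx).eq h1 h2
  rw [surfDiv, surfGrad, M.proj_map T hx]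
  set A := fderivWithin ℝ v (M.elem T) (M.map T x)
  have h4 : LinearMap.toMatrix' (A : (Fin 3 → ℝ) →ₗ[ℝ] (Fin 3 → ℝ)) * M.jac T x =
      piolaJac (M.poly T) p x := by
    apply Matrix.toLin'.injective
    rw [Matrix.toLin'_mul, Matrix.toLin'_toMatrix']
    ext1 j
    ext1
    exact congrArg (fun B : (Fin 2 → ℝ) →L[ℝ] (Fin 3 → ℝ) => B (Pi.single j 1)) h3
  have h5 := Matrix.transpose_mul_self_inv_mul _ (M.gram_pos T hx)
  have h6 := trace_mul_piolaJac (M.poly T) p (M.gram_pos T hx)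
  change _ = (M.J T x)⁻¹ * _ at h6
  rw [← h6, ← h4]
  change _ = ((((M.jac T x)ᵀ * M.jac T x)⁻¹ * (M.jac T x)ᵀ) * _).trace
  generalize ((M.jac T x)ᵀ * M.jac T x)⁻¹ * (M.jac T x)ᵀ = L at h5 ⊢
  generalize M.jac T x = F at h5 ⊢
  generalize LinearMap.toMatrix' (A : (Fin 3 → ℝ) →ₗ[ℝ] (Fin 3 → ℝ)) = B
  rw [Matrix.mul_assoc, Matrix.mul_assoc, Matrix.trace_mul_comm]
  calc (L * (B * (F * L)) * F).trace = ((L * (B * F)) * (L * F)).trace := by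
        simp only [Matrix.mul_assoc]
    _ = _ := by rw [h5, Matrix.mul_one]; rfl

end Piola

/-! ### Edges and cancellation of fluxes -/

/-- The parametrization of the edge `e` of the element `T` over `[0, 1]`. -/
def edgeCurve (T : ι) (e : Fin 3) (s : ℝ) : Fin 3 → ℝ := M.map T (refCurve e s)

/-- The velocity of the parametrization of the edge `e` of the element `T`. -/
def edgeVelocity (T : ι) (e : Fin 3) (s : ℝ) : Fin 3 → ℝ :=
  M.jac T (refCurve e s) *ᵥ refTangent e

theorem hasDerivAt_edgeCurve (T : ι) (e : Fin 3) (s : ℝ) :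
    HasDerivAt (M.edgeCurve T e) (M.edgeVelocity T e s) s :=
  (M.hasFDerivAt_map T _).comp_hasDerivAt s (hasDerivAt_refCurve e s)

theorem edgeCurve_image (T : ι) (e : Fin 3) : M.edgeCurve T e '' Icc 0 1 = M.edge T e := by
  rw [edge, ← refCurve_image, image_image]
  rfl

theorem injOn_edgeCurve (T : ι) (e : Fin 3) : InjOn (M.edgeCurve T e) (Icc 0 1) :=
  fun _ hr _ hs h => refCurve_injective e (M.injOn T (refCurve_mem e hr) (refCurve_mem e hs) h)

theorem refParam_coord_edgeCurve (T : ι) (e : Fin 3) {s : ℝ} (hs : s ∈ Icc (0 : ℝ) 1) :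
    refParam e (M.coord T (M.edgeCurve T e s)) = s := by
  rw [edgeCurve, M.coord_map T (refCurve_mem e hs), refParam_refCurve]

theorem edge_injective (T : ι) : Function.Injective (M.edge T) := fun _ _ h =>
  refEdge_injective ((M.injOn T).image_eq_image_iff (refEdge_subset _) (refEdge_subset _) |>.1 h)

/-- The line integral over an edge is the same for both elements that share the edge. -/
theorem integral_edge_eq {T T' : ι} {e e' : Fin 3} (h : M.edge T e = M.edge T' e')
    (g : (Fin 3 → ℝ) → ℝ) :
    ∫ s in Icc (0 : ℝ) 1,
      g (M.edgeCurve T e s) * √(M.edgeVelocity T e s ⬝ᵥ M.edgeVelocity T e s) =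
    ∫ s in Icc (0 : ℝ) 1,
      g (M.edgeCurve T' e' s) * √(M.edgeVelocity T' e' s ⬝ᵥ M.edgeVelocity T' e' s) := by
  have hex : ∀ r ∈ Icc (0 : ℝ) 1, ∃ s ∈ Icc (0 : ℝ) 1, M.edgeCurve T' e' s = M.edgeCurve T e r := by
    intro r hr
    have hm : M.edgeCurve T e r ∈ M.edge T' e' := h ▸ M.edgeCurve_image T e ▸ mem_image_of_mem _ hr
    rwa [← M.edgeCurve_image] at hm
  have hex' : ∀ s ∈ Icc (0 : ℝ) 1, ∃ r ∈ Icc (0 : ℝ) 1, M.edgeCurve T e r = M.edgeCurve T' e' s := by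
    intro r hr
    have hm : M.edgeCurve T' e' r ∈ M.edge T e :=
      h ▸ M.edgeCurve_image T' e' ▸ mem_image_of_mem _ hr
    rwa [← M.edgeCurve_image] at hm
  -- The parameter change passes through `Φ_T'⁻¹`, which is differentiable within the closed
  -- element, hence along its edges.
  have hψ : ∀ r ∈ Icc (0 : ℝ) 1, DifferentiableWithinAt ℝ
      (fun r => refParam e' (M.coord T' (M.edgeCurve T e r))) (Icc 0 1) r := by
    intro r hr
    obtain ⟨s, hs, hsr⟩ := hex r hr
    have hc : DifferentiableWithinAt ℝ (M.coord T') (M.elem T') (M.edgeCurve T e r) :=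
      hsr ▸ (M.hasFDerivWithinAt_coord T' (refCurve_mem e' hs)).differentiableWithinAt
    refine (differentiable_refParam e' _).comp_differentiableWithinAt r
      (hc.comp r (M.hasDerivAt_edgeCurve T e r).differentiableAt.differentiableWithinAt ?_)
    intro y hy
    obtain ⟨z, hz, hzy⟩ := hex y hy
    exact hzy ▸ mem_image_of_mem _ (refCurve_mem e' hz)
  refine setIntegral_comp_curve_eq measurableSet_Icc (uniqueDiffOn_Icc zero_lt_one)
    (fun r _ => (M.hasDerivAt_edgeCurve T e r).hasDerivWithinAt)
    (fun r _ => (M.hasDerivAt_edgeCurve T' e' r).hasDerivWithinAt)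
    (fun r hr => (hψ r hr).hasDerivWithinAt) (M.injOn_edgeCurve T e) ?_ ?_
    (fun v => √(v ⬝ᵥ v)) ?_ g
  · ext s
    constructor
    · rintro ⟨r, hr, rfl⟩
      obtain ⟨s, hs, hsr⟩ := hex r hr
      simp only [← hsr, M.refParam_coord_edgeCurve T' e' hs]
      exact hs
    · intro hs
      obtain ⟨r, hr, hrs⟩ := hex' s hs
      refine ⟨r, hr, ?_⟩
      simp only [hrs, M.refParam_coord_edgeCurve T' e' hs]
  · intro r hr
    obtain ⟨s, hs, hsr⟩ := hex r hr
    simp only [← hsr, M.refParam_coord_edgeCurve T' e' hs]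
  · intro c v
    simp only [smul_dotProduct, dotProduct_smul, smul_eq_mul]
    rw [← mul_assoc, Real.sqrt_mul (mul_self_nonneg c), Real.sqrt_mul_self_eq_abs]

/-- The Piola transform preserves normal fluxes; the right side no longer involves `p`, so
neighbouring elements can be compared. -/
theorem refFlux_eq_of_eq_piola {T : ι} {v : (Fin 3 → ℝ) → (Fin 3 → ℝ)}
    {p : Fin 2 → MvPolynomial (Fin 2) ℝ}
    (hv : ∀ x ∈ refTriangle, v (M.map T x) = piola (M.poly T) p x) (e : Fin 3) :
    refFlux p e = ∫ s in Icc (0 : ℝ) 1,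
      (v (M.edgeCurve T e s) ⬝ᵥ M.conormal T e (M.edgeCurve T e s)) *
        √(M.edgeVelocity T e s ⬝ᵥ M.edgeVelocity T e s) := by
  refine setIntegral_congr_fun measurableSet_Icc fun s hs => ?_
  have hx := refCurve_mem e hs
  have h := Matrix.piola_dotProduct_conormal (M.gram_pos T hx)
    (fun j => MvPolynomial.eval (refCurve e s) (p j)) (refTangent e) (refTangent_ne_zero e)
  simp only [edgeCurve, conormal, tangent, normal, M.coord_map T hx, hv _ hx]
  exact h.symm

variable {M}

/-- For a field with vanishing normal jumps the fluxes through all edges cancel. -/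
theorem NormalContinuous.sum_refFlux_eq_zero [Fintype ι] {v : ι → (Fin 3 → ℝ) → (Fin 3 → ℝ)}
    (hn : M.NormalContinuous v) {p : ι → Fin 2 → MvPolynomial (Fin 2) ℝ}
    (hv : ∀ T, ∀ x ∈ refTriangle, v T (M.map T x) = piola (M.poly T) (p T) x) :
    ∑ T, ∑ e, refFlux (p T) e = 0 := by
  classical
  rw [← Fintype.sum_prod_type' fun T e => refFlux (p T) e]
  have hmem : ∀ T e, ∀ s ∈ Icc (0 : ℝ) 1, M.edgeCurve T e s ∈ M.edge T e := fun T e s hs =>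
    M.edgeCurve_image T e ▸ mem_image_of_mem _ hs
  let shares : ι × Fin 3 → ι × Fin 3 → Prop := fun a b =>
    b.1 ≠ a.1 ∧ M.edge a.1 a.2 = M.edge b.1 b.2
  -- `σ` swaps the two copies of a shared edge and fixes boundary edges. The partner is unique
  -- (`huniq`), so `σ` is an involution.
  let σ : ι × Fin 3 → ι × Fin 3 := fun a => if h : ∃ b, shares a b then h.choose else a
  have hσ : ∀ a, (∃ b, shares a b) → shares a (σ a) := fun a h => by
    simp only [σ, dif_pos h]
    exact h.choose_spec
  have hσ' : ∀ a, (¬ ∃ b, shares a b) → σ a = a := fun a h => dif_neg h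
  have huniq : ∀ a b c, shares a b → shares a c → b = c := by
    rintro ⟨T, e⟩ ⟨T', e'⟩ ⟨T'', e''⟩ ⟨h1, h2⟩ ⟨h3, h4⟩
    obtain rfl : T' = T'' := M.edge_le_two T T' T'' e e' e'' h1 h3 h2 h4
    obtain rfl : e' = e'' := M.edge_injective T' (h2.symm.trans h4)
    rfl
  have hzero : ∀ a, (¬ ∃ b, shares a b) → refFlux (p a.1) a.2 = 0 := by
    rintro ⟨T, e⟩ h
    rw [M.refFlux_eq_of_eq_piola (hv T)]
    rw [setIntegral_congr_fun (g := fun _ => (0 : ℝ)) measurableSet_Icc, integral_zero]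
    intro s hs
    simp only [hn.2 T e (fun T' e' hT he => h ⟨(T', e'), hT, he.symm⟩) _ (hmem T e s hs), zero_mul]
  refine Finset.sum_involution (fun a _ => σ a) ?_ ?_ (fun _ _ => Finset.mem_univ _) ?_
  · intro a _
    by_cases h : ∃ b, shares a b
    · obtain ⟨h1, h2⟩ := hσ a h
      generalize σ a = b at h1 h2
      obtain ⟨T, e⟩ := a
      obtain ⟨T', e'⟩ := b
      have hneg : ∀ x ∈ M.edge T' e', v T' x ⬝ᵥ M.conormal T' e' x =
          -(v T x ⬝ᵥ M.conormal T e x) := fun x hx =>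
        eq_neg_of_add_eq_zero_right (hn.1 T T' e e' h1.symm h2 x (h2 ▸ hx))
      have h3 : refFlux (p T') e' = -∫ s in Icc (0 : ℝ) 1,
          (v T (M.edgeCurve T' e' s) ⬝ᵥ M.conormal T e (M.edgeCurve T' e' s)) *
            √(M.edgeVelocity T' e' s ⬝ᵥ M.edgeVelocity T' e' s) := by
        rw [M.refFlux_eq_of_eq_piola (hv T'), ← integral_neg]
        refine setIntegral_congr_fun measurableSet_Icc fun s hs => ?_
        simp only [hneg _ (hmem T' e' s hs), neg_mul]
      have h4 := M.integral_edge_eq h2 fun x => v T x ⬝ᵥ M.conormal T e x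
      simp only at h4 ⊢
      rw [M.refFlux_eq_of_eq_piola (hv T), h4, h3, add_neg_cancel]
    · rw [hσ' a h, hzero a h, add_zero]
  · intro a _ h0 h
    by_cases hb : ∃ b, shares a b
    · exact (hσ a hb).1 (congrArg Prod.fst h)
    · exact h0 (hzero a hb)
  · intro a _
    by_cases h : ∃ b, shares a b
    · have h1 := hσ a h
      have h2 : shares (σ a) a := ⟨h1.1.symm, h1.2.symm⟩
      exact huniq _ _ _ (hσ _ ⟨a, h2⟩) h2
    · rw [hσ' a h, hσ' a h]

end SurfaceMesh

/-! ### The test function and the conclusion -/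

open MvPolynomial in
/-- A field in the velocity space that is weakly divergence-free is divergence-free pointwise. -/
theorem SurfaceMesh.surfDiv_eq_zero_of_forall_bForm_eq_zero {ι : Type*} [Fintype ι] {kg : ℕ}
    (M : SurfaceMesh ι kg) (ku : ℕ) (u : ι → (Fin 3 → ℝ) → (Fin 3 → ℝ))
    (hu : u ∈ M.velocitySpace ku) (hb : ∀ q ∈ M.pressureSpace (ku - 1), M.bForm u q = 0) :
    ∀ T, ∀ x ∈ M.elem T,
      DifferentiableWithinAt ℝ (u T) (M.elem T) x ∧ M.surfDiv T (u T) x = 0 := by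
  obtain ⟨hu, hn⟩ := hu
  choose p hdeg hrep using hu
  have hv : ∀ T, ∀ x ∈ refTriangle, u T (M.map T x) = piola (M.poly T) (p T) x := hrep
  have hint : ∀ f : (Fin 2 → ℝ) → ℝ, Continuous f → IntegrableOn f refTriangle :=
    fun f hf => hf.continuousOn.integrableOn_compact isCompact_refTriangle
  have hmeas : MeasurableSet refTriangle := isClosed_refTriangle.measurableSet
  have hzero : ∑ T, ∫ x in refTriangle, eval x (polyDiv (p T)) = 0 := by
    simp only [integral_polyDiv]
    exact hn.sum_refFlux_eq_zero hv
  have hsq : ∑ T, ∫ x in refTriangle, eval x (polyDiv (p T)) ^ 2 = 0 := by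
    -- An empty mesh has area zero, so the mean below could not be formed.
    rcases isEmpty_or_nonempty ι with hι | hι
    · simp
    set A : ℝ := ∑ T, ∫ x in refTriangle, M.J T x with hA
    have hApos : 0 < A := by
      refine Finset.sum_pos (fun T _ => ?_) Finset.univ_nonempty
      rw [setIntegral_pos_iff_support_of_nonneg_ae
        ((ae_restrict_iff' hmeas).2 (.of_forall fun x hx => (M.J_pos T hx).le))
        (hint _ (M.continuous_J T))]
      have hsub : interior refTriangle ⊆ Function.support (M.J T) ∩ refTriangle := fun x hx =>
        ⟨(M.J_pos T (interior_subset hx)).ne', interior_subset hx⟩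
      exact (isOpen_interior.measure_pos volume nonempty_interior_refTriangle).trans_le
        (measure_mono hsub)
    -- `A` is the surface area, and `m` the mean weighted by `J` because the pressure constraint is
    -- an integral over the surface.
    set m : ℝ := (∑ T, ∫ x in refTriangle, eval x (polyDiv (p T)) * M.J T x) / A with hm
    -- The test function comes from `J div_Γ u`, not from `div_Γ u`, whose factor `J⁻¹` is in
    -- general not polynomial.
    let q : ι → (Fin 3 → ℝ) → ℝ := fun T x => eval (M.coord T x) (polyDiv (p T) - C m)
    have hq : q ∈ M.pressureSpace (ku - 1) := by
      refine ⟨fun T => ⟨polyDiv (p T) - C m, ?_, fun x _ => rfl⟩, ?_⟩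
      · have h1 : ∀ j, (pderiv j (p T j)).totalDegree ≤ ku - 1 := fun j =>
          (totalDegree_pderiv_le j _).trans (Nat.sub_le_sub_right (hdeg T j) 1)
        refine (totalDegree_sub_C_le _ _).trans ((totalDegree_add _ _).trans (max_le ?_ ?_))
        · exact h1 0
        · exact h1 1
      · have h1 : ∀ T, ∫ x in refTriangle, q T (M.map T x) * M.J T x =
            (∫ x in refTriangle, eval x (polyDiv (p T)) * M.J T x) -
              m * ∫ x in refTriangle, M.J T x := fun T => by
          rw [← integral_const_mul, ← integral_sub
            (hint (fun x => eval x (polyDiv (p T)) * M.J T x)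
              ((continuous_eval _).mul (M.continuous_J T)))
            (hint (fun x => m * M.J T x) (continuous_const.mul (M.continuous_J T)))]
          refine setIntegral_congr_fun hmeas fun x hx => ?_
          simp only [q, M.coord_map T hx, map_sub, eval_C]
          ring
        rw [SurfaceMesh.surfIntegral, Finset.sum_congr rfl fun T _ => h1 T,
          Finset.sum_sub_distrib, ← Finset.mul_sum, ← hA, hm, div_mul_cancel₀ _ hApos.ne', sub_self]
    have h1 : ∀ T, ∫ x in refTriangle, M.surfDiv T (u T) (M.map T x) * q T (M.map T x) * M.J T x =
        (∫ x in refTriangle, eval x (polyDiv (p T)) ^ 2) -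
          m * ∫ x in refTriangle, eval x (polyDiv (p T)) := fun T => by
      rw [← integral_const_mul, ← integral_sub
        (hint (fun x => eval x (polyDiv (p T)) ^ 2) ((continuous_eval _).pow 2))
        (hint (fun x => m * eval x (polyDiv (p T))) (continuous_const.mul (continuous_eval _)))]
      refine setIntegral_congr_fun hmeas fun x hx => ?_
      have hJ := (M.J_pos T hx).ne'
      simp only [q, M.coord_map T hx, M.surfDiv_of_eq_piola (hv T) hx, map_sub, eval_C]
      field_simp
    have h2 := neg_eq_zero.1 (hb q hq)
    rw [SurfaceMesh.surfIntegral, Finset.sum_congr rfl fun T _ => h1 T,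
      Finset.sum_sub_distrib, ← Finset.mul_sum, hzero, mul_zero, sub_zero] at h2
    exact h2
  have hdiv : ∀ T, ∀ x ∈ refTriangle, eval x (polyDiv (p T)) = 0 := by
    intro T
    have h1 := (Finset.sum_eq_zero_iff_of_nonneg fun T _ =>
      integral_nonneg fun x => sq_nonneg (eval x (polyDiv (p T)))).1 hsq T (Finset.mem_univ T)
    have h2 := (integral_eq_zero_iff_of_nonneg (fun x => sq_nonneg (eval x (polyDiv (p T))))
      (hint _ ((continuous_eval _).pow 2))).1 h1
    -- Continuity upgrades almost everywhere to everywhere, boundary included, since the triangle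
    -- lies in the closure of its interior.
    have h3 := Measure.eqOn_of_ae_eq h2 ((continuous_eval _).pow 2).continuousOn
      continuousOn_const refTriangle_subset_closure_interior
    exact fun x hx => pow_eq_zero_iff two_ne_zero |>.1 (h3 hx)
  rintro T _ ⟨x, hx, rfl⟩
  refine ⟨M.differentiableWithinAt_of_eq_piola (hv T) hx, ?_⟩
  rw [M.surfDiv_of_eq_piola (hv T) hx, hdiv T x hx, mul_zero]

end

theorem lemma1 {ι : Type*} [Fintype ι] {kg : ℕ} (M : SurfaceMesh ι kg) (ku : ℕ) (hku : 1 ≤ ku)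
    (u : ι → (Fin 3 → ℝ) → (Fin 3 → ℝ)) (hu : u ∈ M.velocitySpace ku)
    (hb : ∀ q ∈ M.pressureSpace (ku - 1), M.bForm u q = 0) :
    ∀ T, ∀ x ∈ M.elem T,
      DifferentiableWithinAt ℝ (u T) (M.elem T) x ∧ M.surfDiv T (u T) x = 0 :=
  M.surfDiv_eq_zero_of_forall_bForm_eq_zero ku u hu hb
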